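/- Let $\mathrm{PA}$ be first-order Peano arithmetic (language $0,S,+,\cdot,<$), and code a binary string $r$ of length $N$ by the number whose binary expansion is $1r$. For a number $N$, a rational $\delta>0$ and a formula $R(x)$ with no free variable other than $x$, let $C_{N,\delta,R}$ be the closed arithmetic formula saying that the number of strings $x$ of length $N$ with $\lnot R(x)$ does not exceed $\delta 2^N$ (that is, among any $\lfloor\delta 2^N\rfloor+1$ strings of length $N$ that falsify $R$, two coincide). A proof strategy $\pi$ with initial capital $\varepsilon\ge 0$ is a finite tree. Each vertex carries a set $\Gamma$ of accepted closed formulas and a remaining capital $\rho$; at the root $\Gamma$ is the set of axioms of $\mathrm{PA}$ and $\rho=\varepsilon$. At a vertex the strategy does one of the following: 1. it terminates (the vertex is a leaf); 2. it adds to $\Gamma$ a closed formula derivable from $\Gamma$ in first-order logic, leaving the capital unchanged; 3. it makes a random step: for some $N$, some rational $\delta$ with $0<\delta\le\rho$ and some $R(x)$ such that $C_{N,\delta,R}\in\Gamma$ (it has already been proved or accepted), a fair coin is tossed $N$ times, giving a string $r$ of length $N$; the formula $R(r)$ is added to $\Gamma$, the capital becomes $\rho-\delta$, and the strategy continues in a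 way that may depend on $r$. Let $F$ be a closed arithmetic formula. If the probability (over the coin tosses) that $F$ belongs to the set of accepted formulas when $\pi$ terminates is greater than $\varepsilon$, then $F$ is provable in $\mathrm{PA}$. -/

import Mathlib

noncomputable section

namespace RandomAxioms

open FirstOrder FirstOrder.Language

/-! ### The language of arithmetic `0, S, +, ·, <` -/

inductive ArithFunc : ℕ → Type
  | zero : ArithFunc 0
  | succ : ArithFunc 1
  | add : ArithFunc 2
  | mul : ArithFunc 2

inductive ArithRel : ℕ → Type
  | lt : ArithRel 2

abbrev arith : FirstOrder.Language.{0, 0} where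
  Functions := ArithFunc
  Relations := ArithRel

variable {α : Type}

def zero : arith.Term α := Constants.term (L := arith) ArithFunc.zero

def succ (t : arith.Term α) : arith.Term α := Functions.apply₁ (L := arith) ArithFunc.succ t

def add (s t : arith.Term α) : arith.Term α := Functions.apply₂ (L := arith) ArithFunc.add s t

def mul (s t : arith.Term α) : arith.Term α := Functions.apply₂ (L := arith) ArithFunc.mul s t

def lt (s t : arith.Term α) : arith.Formula α := Relations.formula₂ (L := arith) ArithRel.lt s t

/-- The numeral `S ⋯ S 0`. -/
def numeral : ℕ → arith.Term α
  | 0 => zero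
  | n + 1 => succ (numeral n)

/-- `∀ x₀ ⋯ ∀ xₙ₋₁, χ`, where the variables `Sum.inr i` of `χ` become the quantified `xᵢ`. -/
def univ {n : ℕ} (χ : arith.Formula (α ⊕ Fin n)) : arith.Formula α :=
  BoundedFormula.alls (n := n) (BoundedFormula.relabel id χ)

/-- Substitution of the terms `t i` for the variables `Sum.inr i`. -/
def inst {n : ℕ} (χ : arith.Formula (α ⊕ Fin n)) (t : Fin n → arith.Term α) : arith.Formula α :=
  BoundedFormula.subst χ (Sum.elim Term.var t)

/-! ### Provability -/

/-- Classical natural deduction with equality: `Provable Γ φ` says that there is a derivation of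
`φ` from assumptions in `Γ`. The type `α` is the set of free variables that may occur. In the
rule `univ_intro` the variables `Sum.inr i` are fresh, since the assumptions do not contain them.
The quantifier rules treat a block of `n` quantifiers at once; `n = 1` gives the usual rules. -/
inductive Provable : {α : Type} → Set (arith.Formula α) → arith.Formula α → Prop
  | assumption {α : Type} {Γ : Set (arith.Formula α)} {φ : arith.Formula α} :
      φ ∈ Γ → Provable Γ φ
  | imp_intro {α : Type} {Γ : Set (arith.Formula α)} {φ ψ : arith.Formula α} :
      Provable (insert φ Γ) ψ → Provable Γ (φ.imp ψ)
  | imp_elim {α : Type} {Γ : Set (arith.Formula α)} {φ ψ : arith.Formula α} :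
      Provable Γ (φ.imp ψ) → Provable Γ φ → Provable Γ ψ
  | by_contradiction {α : Type} {Γ : Set (arith.Formula α)} {φ : arith.Formula α} :
      Provable (insert φ.not Γ) ⊥ → Provable Γ φ
  | univ_intro {α : Type} {Γ : Set (arith.Formula α)} {n : ℕ} {χ : arith.Formula (α ⊕ Fin n)} :
      Provable ((fun φ : arith.Formula α => φ.subst fun a => Term.var (Sum.inl a)) '' Γ) χ →
        Provable Γ (univ χ)
  | univ_elim {α : Type} {Γ : Set (arith.Formula α)} {n : ℕ} {χ : arith.Formula (α ⊕ Fin n)}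
      (t : Fin n → arith.Term α) : Provable Γ (univ χ) → Provable Γ (inst χ t)
  | eq_refl {α : Type} {Γ : Set (arith.Formula α)} (t : arith.Term α) :
      Provable Γ (t.equal t)
  | eq_subst {α : Type} {Γ : Set (arith.Formula α)} {s t : arith.Term α}
      (χ : arith.Formula (α ⊕ Fin 1)) :
      Provable Γ (s.equal t) → Provable Γ (inst χ fun _ => s) → Provable Γ (inst χ fun _ => t)

/-! ### Peano arithmetic -/

/-- The variable `xᵢ` of a block of `n` quantified variables. -/
def x {n : ℕ} (i : Fin n) : arith.Term (α ⊕ Fin n) := Term.var (Sum.inr i)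

/-- The axioms of formal (first-order Peano) arithmetic. The formula `φ` of an induction axiom may contain `n`
parameters, which are universally quantified. -/
inductive IsAxiom : arith.Sentence → Prop
  | succ_ne_zero : IsAxiom (univ (n := 1) (Term.equal (succ (x 0)) zero).not)
  | succ_inj : IsAxiom (univ (n := 2)
      (((succ (x 0)).equal (succ (x 1))).imp ((x 0).equal (x 1))))
  | add_zero : IsAxiom (univ (n := 1) ((add (x 0) zero).equal (x 0)))
  | add_succ : IsAxiom (univ (n := 2) ((add (x 0) (succ (x 1))).equal (succ (add (x 0) (x 1)))))
  | mul_zero : IsAxiom (univ (n := 1) ((mul (x 0) zero).equal zero))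
  | mul_succ : IsAxiom (univ (n := 2) ((mul (x 0) (succ (x 1))).equal (add (mul (x 0) (x 1)) (x 0))))
  | not_lt_zero : IsAxiom (univ (n := 1) (lt (x 0) zero).not)
  | lt_succ : IsAxiom (univ (n := 2)
      ((lt (x 0) (succ (x 1))).iff (lt (x 0) (x 1) ⊔ (x 0).equal (x 1))))
  | induction {n : ℕ} (φ : arith.Formula ((Empty ⊕ Fin n) ⊕ Fin 1)) :
      IsAxiom (univ ((inst φ fun _ => zero).imp
        ((univ (φ.imp
          (φ.subst (Sum.elim (fun a => Term.var (Sum.inl a)) fun _ => succ (x 0))))).imp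
          (univ φ))))

def PA : arith.Theory := {φ | IsAxiom φ}

/-! ### Binary strings in arithmetic -/

/-- The code of a binary string of length `N`: the number whose binary expansion is a leading `1`
followed by the string. -/
def code {N : ℕ} (r : Fin N → Bool) : ℕ := 2 ^ N + Nat.ofBits r

/-- `t` is (the code of) a string of length `N`, i.e. `2 ^ N ≤ t < 2 ^ (N + 1)`. -/
def isString (N : ℕ) (t : arith.Term α) : arith.Formula α :=
  (lt t (numeral (2 ^ N))).not ⊓ lt t (numeral (2 ^ (N + 1)))

/-- `R(t)` for a property `R` with one free variable. -/
def apply (R : arith.Formula (Fin 1)) (t : arith.Term α) : arith.Formula α :=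
  BoundedFormula.subst R fun _ => t

/-- The closed formula "at most `k` strings of length `N` falsify `R`": among any `k + 1` strings
of length `N` that falsify `R`, two are equal. -/
def atMost (k N : ℕ) (R : arith.Formula (Fin 1)) : arith.Sentence :=
  univ (n := k + 1)
    ((Formula.iInf fun i : Fin (k + 1) => isString N (x i) ⊓ (apply R (x i)).not).imp
      (Formula.iSup fun p : {p : Fin (k + 1) × Fin (k + 1) // p.1 < p.2} =>
        (x p.1.1).equal (x p.1.2)))

/-- The closed formula "the number of strings of length `N` that falsify `R` does not exceed
`δ * 2 ^ N`". -/
def fewFalsify (δ : ℚ) (N : ℕ) (R : arith.Formula (Fin 1)) : arith.Sentence :=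
  atMost ⌊δ * 2 ^ N⌋₊ N R

/-! ### Proof strategies -/

/-- A proof strategy is a finite tree. At a vertex it terminates, or derives a formula from the
statements accepted so far, or makes a random step: `N` coin tosses give a string `r`, the formula
`R(r)` is accepted, `δ` is paid, and the strategy goes on in a way that depends on `r`. -/
inductive Strategy : Type
  | leaf : Strategy
  | derive (φ : arith.Sentence) (next : Strategy) : Strategy
  | random (N : ℕ) (δ : ℚ) (R : arith.Formula (Fin 1)) (next : (Fin N → Bool) → Strategy) :
      Strategy

/-- All steps are legal if `Γ` is the set of the statements accepted so far and `ρ` is the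
remaining capital. -/
def Strategy.Legal : Strategy → arith.Theory → ℝ → Prop
  | .leaf, _, _ => True
  | .derive φ next, Γ, ρ => Provable Γ φ ∧ next.Legal (insert φ Γ) ρ
  | .random N δ R next, Γ, ρ =>
      0 < δ ∧ (δ : ℝ) ≤ ρ ∧ fewFalsify δ N R ∈ Γ ∧
        ∀ r, (next r).Legal (insert (apply R (numeral (code r))) Γ) (ρ - δ)

/-- The distribution of the set of all accepted statements at the end, if it is `Γ` at the
beginning and the coin is fair. -/
def Strategy.run : Strategy → arith.Theory → PMF arith.Theory
  | .leaf, Γ => PMF.pure Γ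
  | .derive φ next, Γ => next.run (insert φ Γ)
  | .random N _ R next, Γ =>
      (PMF.uniformOfFintype (Fin N → Bool)).bind fun r =>
        (next r).run (insert (apply R (numeral (code r))) Γ)

/-- The probability that the strategy, starting from the axioms of arithmetic, gets `F`. -/
def Strategy.prob (π : Strategy) (F : arith.Sentence) : ENNReal :=
  (π.run PA).toOuterMeasure {Γ | F ∈ Γ}

end RandomAxioms

end

/-!
The capital is a bound on the probability of ever accepting a given unprovable formula. Suppose
that `Γ ⊬ F` and that a random step is made for a formula `R` with at most `k = ⌊δ 2^N⌋` strings
falsifying it, as `Γ` certifies. If `Γ, R(r) ⊢ F` then `Γ, ¬F ⊢ ¬R(r)`; were this so for more than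
`k` strings `r`, the pigeonhole statement in `Γ` would give `Γ, ¬F ⊢ ⊥`, because arithmetic proves
that distinct numerals are distinct. So `F` becomes provable with probability at most `δ`, and in
the remaining cases the bound `ρ - δ` applies by induction on the strategy.
-/

namespace RandomAxioms

open FirstOrder FirstOrder.Language

section Substitution

variable {L : FirstOrder.Language} {α β γ : Type*} {n : ℕ}

theorem term_relabel_subst (t : L.Term α) (g : α → β) (f : β → L.Term γ) :
    (t.relabel g).subst f = t.subst (f ∘ g) := by
  induction t with
  | var a => rfl
  | func F ts ih => simp only [Term.relabel, Term.subst, ih]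

theorem term_subst_relabel (t : L.Term α) (f : α → L.Term β) (g : β → γ) :
    (t.subst f).relabel g = t.subst fun a => (f a).relabel g := by
  induction t with
  | var a => rfl
  | func F ts ih => simp only [Term.relabel, Term.subst, ih]

theorem term_subst_subst (t : L.Term α) (f : α → L.Term β) (g : β → L.Term γ) :
    (t.subst f).subst g = t.subst fun a => (f a).subst g := by
  induction t with
  | var a => rfl
  | func F ts ih => simp only [Term.subst, ih]

theorem term_subst_var (t : L.Term α) : t.subst Term.var = t := by
  induction t with
  | var a => rfl
  | func F ts ih => simp only [Term.subst, ih]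

theorem subst_subst (φ : L.BoundedFormula α n) (f : α → L.Term β) (g : β → L.Term γ) :
    (φ.subst f).subst g = φ.subst fun a => (f a).subst g := by
  unfold BoundedFormula.subst
  rw [BoundedFormula.mapTermRel_mapTermRel]
  congr 1
  funext k t
  rw [Function.comp_apply, term_subst_subst]
  congr 1
  funext a
  rcases a with a | i
  · simp only [Sum.elim_inl, Function.comp_apply, term_relabel_subst, term_subst_relabel]
    rfl
  · rfl

theorem imp_subst (φ ψ : L.BoundedFormula α n) (f : α → L.Term β) :
    (φ.imp ψ).subst f = (φ.subst f).imp (ψ.subst f) := rfl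

theorem not_subst (φ : L.BoundedFormula α n) (f : α → L.Term β) :
    φ.not.subst f = (φ.subst f).not := rfl

theorem inf_subst (φ ψ : L.BoundedFormula α n) (f : α → L.Term β) :
    (φ ⊓ ψ).subst f = φ.subst f ⊓ ψ.subst f := rfl

theorem sup_subst (φ ψ : L.BoundedFormula α n) (f : α → L.Term β) :
    (φ ⊔ ψ).subst f = φ.subst f ⊔ ψ.subst f := rfl

theorem iff_subst (φ ψ : L.BoundedFormula α n) (f : α → L.Term β) :
    (φ.iff ψ).subst f = (φ.subst f).iff (ψ.subst f) := rfl

theorem iInf_subst {ι : Type*} [Finite ι] (φ : ι → L.Formula α) (f : α → L.Term β) :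
    BoundedFormula.subst (Formula.iInf φ) f =
      Formula.iInf fun i => BoundedFormula.subst (φ i) f := by
  simp only [Formula.iInf, BoundedFormula.iInf]
  generalize Finset.toList _ = l
  induction l with
  | nil => rfl
  | cons i l ih => exact congrArg (BoundedFormula.subst (φ i) f ⊓ ·) ih

theorem iSup_subst {ι : Type*} [Finite ι] (φ : ι → L.Formula α) (f : α → L.Term β) :
    BoundedFormula.subst (Formula.iSup φ) f =
      Formula.iSup fun i => BoundedFormula.subst (φ i) f := by
  simp only [Formula.iSup, BoundedFormula.iSup]
  generalize Finset.toList _ = l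
  induction l with
  | nil => rfl
  | cons i l ih => exact congrArg (BoundedFormula.subst (φ i) f ⊔ ·) ih

-- The left-hand side is what `BoundedFormula.subst` does to a term without bound variables in it.
theorem relabel_inl_subst (t : L.Term α) (f : α → L.Term β) :
    (t.relabel (Sum.inl : α → α ⊕ Fin n)).subst
        (Sum.elim (Term.relabel Sum.inl ∘ f) (Term.var ∘ Sum.inr)) =
      (t.subst f).relabel Sum.inl := by
  rw [term_relabel_subst, term_subst_relabel]
  rfl

theorem equal_subst (s t : L.Term α) (f : α → L.Term β) :
    BoundedFormula.subst (s.equal t) f = (s.subst f).equal (t.subst f) :=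
  congrArg₂ BoundedFormula.equal (relabel_inl_subst s f) (relabel_inl_subst t f)

end Substitution

section ArithmeticSubstitution

variable {α β : Type} (f : α → arith.Term β)

theorem zero_subst : (zero : arith.Term α).subst f = zero :=
  congrArg (Term.func (L := arith) ArithFunc.zero) (Subsingleton.elim _ _)

theorem succ_subst (t : arith.Term α) : (succ t).subst f = succ (t.subst f) := by
  refine congrArg (Term.func (L := arith) ArithFunc.succ) ?_
  funext i
  fin_cases i
  rfl

theorem numeral_subst (n : ℕ) : (numeral n : arith.Term α).subst f = numeral n := by
  induction n with
  | zero => exact zero_subst f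
  | succ n ih => rw [numeral, succ_subst, ih, numeral]

theorem lt_subst (s t : arith.Term α) :
    BoundedFormula.subst (lt s t) f = lt (s.subst f) (t.subst f) := by
  refine congrArg (BoundedFormula.rel (L := arith) ArithRel.lt) ?_
  funext i
  fin_cases i
  · exact relabel_inl_subst s f
  · exact relabel_inl_subst t f

theorem isString_subst (N : ℕ) (t : arith.Term α) :
    BoundedFormula.subst (isString N t) f = isString N (t.subst f) := by
  simp only [isString, inf_subst, not_subst, lt_subst, numeral_subst]

theorem apply_subst (R : arith.Formula (Fin 1)) (t : arith.Term α) :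
    BoundedFormula.subst (apply R t) f = apply R (t.subst f) :=
  subst_subst R _ _

theorem x_subst {n : ℕ} (i : Fin n) (t : Fin n → arith.Term α) :
    (x i).subst (Sum.elim Term.var t) = t i := rfl

end ArithmeticSubstitution

namespace Provable

variable {α : Type} {Γ Δ : Set (arith.Formula α)} {φ ψ : arith.Formula α}

theorem mono (h : Provable Γ φ) (hΓ : Γ ⊆ Δ) : Provable Δ φ := by
  induction h with
  | assumption h => exact assumption (hΓ h)
  | imp_intro _ ih => exact imp_intro (ih (Set.insert_subset_insert hΓ))
  | imp_elim _ _ ih₁ ih₂ => exact imp_elim (ih₁ hΓ) (ih₂ hΓ)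
  | by_contradiction _ ih => exact by_contradiction (ih (Set.insert_subset_insert hΓ))
  | univ_intro _ ih => exact univ_intro (ih (Set.image_mono hΓ))
  | univ_elim t _ ih => exact univ_elim t (ih hΓ)
  | eq_refl t => exact eq_refl t
  | eq_subst χ _ _ ih₁ ih₂ => exact eq_subst χ (ih₁ hΓ) (ih₂ hΓ)

theorem weaken (h : Provable Γ φ) : Provable (insert ψ Γ) φ := h.mono (Set.subset_insert _ _)

theorem head : Provable (insert φ Γ) φ := assumption (Set.mem_insert _ _)

theorem cut (h : Provable Γ φ) (h' : Provable (insert φ Γ) ψ) : Provable Γ ψ :=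
  imp_elim (imp_intro h') h

theorem not_elim (h : Provable Γ φ.not) (h' : Provable Γ φ) : Provable Γ ⊥ := imp_elim h h'

theorem exfalso (h : Provable Γ ⊥) : Provable Γ φ := by_contradiction h.weaken

theorem mt (h : Provable Γ (φ.imp ψ)) (h' : Provable Γ ψ.not) : Provable Γ φ.not :=
  imp_intro (not_elim h'.weaken (imp_elim h.weaken head))

theorem contrapose (h : Provable (insert φ Γ) ψ) : Provable (insert ψ.not Γ) φ.not :=
  mt (imp_intro h).weaken head

theorem inf_intro (h : Provable Γ φ) (h' : Provable Γ ψ) : Provable Γ (φ ⊓ ψ) :=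
  imp_intro (not_elim (imp_elim head h.weaken) h'.weaken)

theorem inf_left (h : Provable Γ (φ ⊓ ψ)) : Provable Γ φ :=
  by_contradiction (imp_elim h.weaken (imp_intro (exfalso (not_elim head.weaken head))))

theorem inf_right (h : Provable Γ (φ ⊓ ψ)) : Provable Γ ψ :=
  by_contradiction (imp_elim h.weaken (imp_intro head.weaken))

theorem sup_inl (h : Provable Γ φ) : Provable Γ (φ ⊔ ψ) :=
  imp_intro (exfalso (not_elim head h.weaken))

theorem sup_inr (h : Provable Γ ψ) : Provable Γ (φ ⊔ ψ) := imp_intro h.weaken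

theorem not_sup (h : Provable Γ φ.not) (h' : Provable Γ ψ.not) : Provable Γ (φ ⊔ ψ).not :=
  imp_intro (not_elim h'.weaken (imp_elim head h.weaken))

theorem iInf_intro {ι : Type*} [Finite ι] {φ : ι → arith.Formula α}
    (h : ∀ i, Provable Γ (φ i)) : Provable Γ (Formula.iInf φ) := by
  simp only [Formula.iInf, BoundedFormula.iInf]
  generalize Finset.toList _ = l
  induction l with
  | nil => exact imp_intro head
  | cons i l ih => exact inf_intro (h i) ih

theorem not_iSup {ι : Type*} [Finite ι] {φ : ι → arith.Formula α}
    (h : ∀ i, Provable Γ (φ i).not) : Provable Γ (Formula.iSup φ).not := by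
  simp only [Formula.iSup, BoundedFormula.iSup]
  generalize Finset.toList _ = l
  induction l with
  | nil => exact imp_intro head
  | cons i l ih => exact not_sup (h i) ih

theorem eq_symm {s t : arith.Term α} (h : Provable Γ (s.equal t)) : Provable Γ (t.equal s) := by
  have rewrite_left := eq_subst ((x 0).equal (s.relabel Sum.inl)) h
  have relabel_inst (u : arith.Term α) :
      (s.relabel Sum.inl).subst (Sum.elim Term.var fun _ : Fin 1 => u) = s := by
    rw [term_relabel_subst, Sum.elim_comp_inl, term_subst_var]
  simp only [inst, equal_subst, x_subst, relabel_inst] at rewrite_left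
  exact rewrite_left (eq_refl s)

end Provable

open Provable

/-- The theory `Γ` settles every equation between distinct numerals and every inequality between
numerals, correctly. This is all that a base theory needs to reason about codes of strings. -/
structure DecidesNumerals (Γ : arith.Theory) : Prop where
  numeral_ne {m n : ℕ} : m ≠ n → Provable Γ ((numeral m).equal (numeral n)).not
  numeral_lt {m n : ℕ} : m < n → Provable Γ (lt (numeral m) (numeral n))
  numeral_not_lt {m n : ℕ} : n ≤ m → Provable Γ (lt (numeral m) (numeral n)).not

namespace PA

variable (s t : arith.Term Empty)

theorem succ_ne_zero : Provable PA ((succ s).equal zero).not := by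
  have h := univ_elim (fun _ => s) (assumption (Γ := PA) IsAxiom.succ_ne_zero)
  simpa only [inst, not_subst, equal_subst, succ_subst, zero_subst, x_subst] using h

theorem succ_inj : Provable PA (((succ s).equal (succ t)).imp (s.equal t)) := by
  have h := univ_elim ![s, t] (assumption (Γ := PA) IsAxiom.succ_inj)
  simpa only [inst, imp_subst, equal_subst, succ_subst, x_subst, Matrix.cons_val_zero,
    Matrix.cons_val_one] using h

theorem not_lt_zero : Provable PA (lt s zero).not := by
  have h := univ_elim (fun _ => s) (assumption (Γ := PA) IsAxiom.not_lt_zero)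
  simpa only [inst, not_subst, lt_subst, zero_subst, x_subst] using h

theorem lt_succ : Provable PA ((lt s (succ t)).iff (lt s t ⊔ s.equal t)) := by
  have h := univ_elim ![s, t] (assumption (Γ := PA) IsAxiom.lt_succ)
  simpa only [inst, iff_subst, sup_subst, lt_subst, equal_subst, succ_subst, x_subst,
    Matrix.cons_val_zero, Matrix.cons_val_one] using h

theorem numeral_ne {m n : ℕ} (h : m ≠ n) : Provable PA ((numeral m).equal (numeral n)).not := by
  induction m generalizing n with
  | zero =>
    cases n with
    | zero => exact absurd rfl h
    | succ n => exact imp_intro (not_elim (succ_ne_zero (numeral n)).weaken (eq_symm head))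
  | succ m ih =>
    cases n with
    | zero => exact succ_ne_zero (numeral m)
    | succ n => exact mt (succ_inj _ _) (ih (by lia))

theorem numeral_lt {m n : ℕ} (h : m < n) : Provable PA (lt (numeral m) (numeral n)) := by
  induction n with
  | zero => exact absurd h (Nat.not_lt_zero m)
  | succ n ih =>
    refine imp_elim (inf_right (lt_succ (numeral m) (numeral n))) ?_
    rcases Nat.lt_succ_iff_lt_or_eq.mp h with h | rfl
    · exact sup_inl (ih h)
    · exact sup_inr (eq_refl _)

theorem numeral_not_lt {m n : ℕ} (h : n ≤ m) :
    Provable PA (lt (numeral m) (numeral n)).not := by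
  induction n with
  | zero => exact not_lt_zero _
  | succ n ih =>
    exact mt (inf_left (lt_succ (numeral m) (numeral n)))
      (not_sup (ih (by lia)) (numeral_ne (by lia)))

theorem decidesNumerals : DecidesNumerals PA := ⟨numeral_ne, numeral_lt, numeral_not_lt⟩

end PA

theorem code_injective (N : ℕ) : Function.Injective (code : (Fin N → Bool) → ℕ) := by
  intro r s h
  have hbits : Nat.ofBits r = Nat.ofBits s := Nat.add_left_cancel h
  funext i
  rw [← Nat.testBit_ofBits_lt r i i.2, hbits, Nat.testBit_ofBits_lt s i i.2]

theorem code_lt_two_pow_succ {N : ℕ} (r : Fin N → Bool) : code r < 2 ^ (N + 1) := by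
  have h := Nat.ofBits_lt_two_pow r
  rw [code, pow_succ]
  lia

namespace DecidesNumerals

variable {Γ Δ : arith.Theory} {k N : ℕ} {R : arith.Formula (Fin 1)} {F : arith.Sentence}

theorem mono (h : DecidesNumerals Γ) (hΓ : Γ ⊆ Δ) : DecidesNumerals Δ :=
  ⟨fun hne => (h.numeral_ne hne).mono hΓ, fun hlt => (h.numeral_lt hlt).mono hΓ,
    fun hle => (h.numeral_not_lt hle).mono hΓ⟩

theorem weaken (h : DecidesNumerals Γ) : DecidesNumerals (insert F Γ) :=
  h.mono (Set.subset_insert _ _)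

theorem isString_code (h : DecidesNumerals Γ) (r : Fin N → Bool) :
    Provable Γ (isString N (numeral (code r))) :=
  inf_intro (h.numeral_not_lt (Nat.le_add_right _ _)) (h.numeral_lt (code_lt_two_pow_succ r))

theorem provable_falsum_of_atMost (h : DecidesNumerals Γ) (hC : Provable Γ (atMost k N R))
    (r : Fin (k + 1) ↪ (Fin N → Bool))
    (hr : ∀ i, Provable Γ (apply R (numeral (code (r i)))).not) : Provable Γ ⊥ := by
  have pigeonhole := univ_elim (fun i => numeral (code (r i))) hC
  simp only [inst, imp_subst, iInf_subst, iSup_subst, inf_subst, not_subst, isString_subst,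
    apply_subst, equal_subst, x_subst] at pigeonhole
  refine not_elim (not_iSup fun p => ?_) (imp_elim pigeonhole (iInf_intro fun i => ?_))
  · exact h.numeral_ne ((code_injective N).ne (r.injective.ne p.2.ne))
  · exact inf_intro (h.isString_code (r i)) (hr i)

theorem card_le_of_not_provable (h : DecidesNumerals Γ) (hC : Provable Γ (atMost k N R))
    (hF : ¬ Provable Γ F) {B : Finset (Fin N → Bool)}
    (hB : ∀ r ∈ B, Provable (insert (apply R (numeral (code r))) Γ) F) : B.card ≤ k := by
  by_contra! hk
  obtain ⟨r, hr⟩ : ∃ r : Fin (k + 1) ↪ (Fin N → Bool), Set.range r ⊆ B :=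
    Function.Embedding.exists_of_card_le_finset (by simpa using hk)
  exact hF (by_contradiction (h.weaken.provable_falsum_of_atMost hC.weaken r fun i =>
    contrapose (hB (r i) (hr ⟨i, rfl⟩))))

end DecidesNumerals

theorem toOuterMeasure_le_one {α : Type*} (p : PMF α) (s : Set α) : p.toOuterMeasure s ≤ 1 := by
  rw [← (p.toOuterMeasure_apply_eq_one_iff Set.univ).mpr (Set.subset_univ _)]
  exact MeasureTheory.measure_mono (Set.subset_univ s)

theorem toOuterMeasure_bind_le {α β : Type*} (p : PMF α) (f : α → PMF β) {A : Set α} {s : Set β}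
    {c : ENNReal} (hc : ∀ a ∉ A, (f a).toOuterMeasure s ≤ c) :
    (p.bind f).toOuterMeasure s ≤ p.toOuterMeasure A + c := by
  have pointwise (a : α) : p a * (f a).toOuterMeasure s ≤ A.indicator p a + p a * c := by
    by_cases ha : a ∈ A
    · rw [Set.indicator_of_mem ha]
      exact (mul_le_of_le_one_right' (toOuterMeasure_le_one (f a) s)).trans le_self_add
    · exact (mul_le_mul_right (hc a ha) (p a)).trans le_add_self
  calc (p.bind f).toOuterMeasure s
      = ∑' a, p a * (f a).toOuterMeasure s := PMF.toOuterMeasure_bind_apply p f s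
    _ ≤ ∑' a, (A.indicator p a + p a * c) := ENNReal.tsum_le_tsum pointwise
    _ = p.toOuterMeasure A + c := by
      rw [ENNReal.tsum_add, ENNReal.tsum_mul_right, p.tsum_coe, one_mul, PMF.toOuterMeasure_apply]

theorem toOuterMeasure_uniformOfFintype_le {α : Type*} [Fintype α] [Nonempty α] {A : Finset α}
    {δ : ℝ} (hA : A.card ≤ δ * Fintype.card α) :
    (PMF.uniformOfFintype α).toOuterMeasure A ≤ ENNReal.ofReal δ := by
  rw [PMF.toOuterMeasure_uniformOfFintype_apply]
  refine ENNReal.div_le_of_le_mul ?_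
  simpa [ENNReal.ofReal_mul'] using ENNReal.ofReal_le_ofReal hA

theorem Strategy.run_le_of_not_provable (π : Strategy) {Γ : arith.Theory} {ρ : ℝ}
    {F : arith.Sentence} (hΓ : DecidesNumerals Γ) (hπ : π.Legal Γ ρ) (hF : ¬ Provable Γ F) :
    (π.run Γ).toOuterMeasure {Δ | F ∈ Δ} ≤ ENNReal.ofReal ρ := by
  classical
  induction π generalizing Γ ρ with
  | leaf =>
    have hFΓ : F ∉ Γ := fun h => hF (assumption h)
    simp [Strategy.run, hFΓ]
  | derive φ next ih => exact ih hΓ.weaken hπ.2 fun h => hF (cut hπ.1 h)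
  | random N δ R next ih =>
    obtain ⟨hδ, hδρ, hC, hnext⟩ := hπ
    let B : Finset (Fin N → Bool) := {r | Provable (insert (apply R (numeral (code r))) Γ) F}
    have hfloor : B.card ≤ ⌊δ * 2 ^ N⌋₊ :=
      hΓ.card_le_of_not_provable (assumption hC) hF fun r hr => (Finset.mem_filter.mp hr).2
    have hB : (B.card : ℝ) ≤ δ * Fintype.card (Fin N → Bool) := by
      rw [Fintype.card_fun, Fintype.card_bool, Fintype.card_fin]
      exact_mod_cast (Nat.le_floor_iff (by positivity)).mp hfloor
    have hcontinue (r) (hr : r ∉ (B : Set (Fin N → Bool))) :=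
      ih r hΓ.weaken (hnext r) fun h => hr (by simpa [B] using h)
    calc ((random N δ R next).run Γ).toOuterMeasure {Δ | F ∈ Δ}
        ≤ (PMF.uniformOfFintype (Fin N → Bool)).toOuterMeasure B + ENNReal.ofReal (ρ - δ) :=
          toOuterMeasure_bind_le _ _ hcontinue
      _ ≤ ENNReal.ofReal δ + ENNReal.ofReal (ρ - δ) := by
          gcongr
          exact toOuterMeasure_uniformOfFintype_le hB
      _ = ENNReal.ofReal ρ := by
          rw [← ENNReal.ofReal_add (by positivity) (sub_nonneg.mpr hδρ), add_sub_cancel]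

end RandomAxioms

theorem proposition2_general {Γ : RandomAxioms.arith.Theory}
    (hΓ : RandomAxioms.DecidesNumerals Γ) {ε : ℝ} {π : RandomAxioms.Strategy}
    (hπ : π.Legal Γ ε) {F : RandomAxioms.arith.Sentence}
    (hF : ENNReal.ofReal ε < (π.run Γ).toOuterMeasure {Δ | F ∈ Δ}) :
    RandomAxioms.Provable Γ F :=
  not_imp_comm.mp (π.run_le_of_not_provable hΓ hπ) hF.not_ge

theorem proposition2 (ε : ℝ) (hε : 0 ≤ ε) (π : RandomAxioms.Strategy)
    (hπ : π.Legal RandomAxioms.PA ε) (F : RandomAxioms.arith.Sentence)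
    (hF : ENNReal.ofReal ε < π.prob F) :
    RandomAxioms.Provable RandomAxioms.PA F :=
  proposition2_general RandomAxioms.PA.decidesNumerals hπ hF
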